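/- All spaces are real. Let $\mathbb{X}=\ell_\infty^3$, that is, $\mathbb{R}^3$ with the supremum norm, and let $\mathbb{Y}$ be a two-dimensional polygonal Banach space, that is, a two-dimensional real Banach space whose closed unit ball $B_{\mathbb{Y}}$ has only finitely many extreme points. Let $T:\mathbb{X}\to\mathbb{Y}$ be a bounded linear operator with $\|T\|=1$. Write $Ext(B_{\mathbb{X}})$ and $Ext(B_{\mathbb{Y}})$ for the sets of extreme points of the closed unit balls, and $M_T=\{x\in\mathbb{X}:\|x\|=1,\ \|Tx\|=\|T\|\}$ for the norm attainment set of $T$. Then $T$ is an extreme contraction (that is, an extreme point of the closed unit ball of the space $\mathbb{L}(\mathbb{X},\mathbb{Y})$ of bounded linear operators with the operator norm) if and only if $$|M_T\cap Ext(B_{\mathbb{X}})|\ge 6\quad\text{and}\quad T(M_T\cap Ext(B_{\mathbb{X}}))\subseteq Ext(B_{\mathbb{Y}}).$$ -/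

import Mathlib

/-- The set `Ext(B_E)` of extreme points of the closed unit ball of a real normed space. -/
def extBall (E : Type*) [NormedAddCommGroup E] [NormedSpace ℝ E] : Set E :=
  (Metric.closedBall (0 : E) 1).extremePoints ℝ

/-- The norm attainment set `M_T` of a bounded linear operator: the unit vectors `x` with
`‖T x‖ = ‖T‖`. -/
def normAttainmentSet {E F : Type*} [NormedAddCommGroup E] [NormedSpace ℝ E]
    [NormedAddCommGroup F] [NormedSpace ℝ F] (T : E →L[ℝ] F) : Set E :=
  {x | ‖x‖ = 1 ∧ ‖T x‖ = ‖T‖}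

/-- An extreme contraction is an extreme point of the closed unit ball of the space of bounded
linear operators, with the operator norm. -/
def IsExtremeContraction {E F : Type*} [NormedAddCommGroup E] [NormedSpace ℝ E]
    [NormedAddCommGroup F] [NormedSpace ℝ F] (T : E →L[ℝ] F) : Prop :=
  T ∈ extBall (E →L[ℝ] F)

/-- A two-dimensional polygonal Banach space: a two-dimensional real normed space (automatically
complete) whose closed unit ball has only finitely many extreme points. -/
def IsPolygonalPlane (F : Type*) [NormedAddCommGroup F] [NormedSpace ℝ F] : Prop :=
  Module.finrank ℝ F = 2 ∧ (extBall F).Finite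

/-! A point of a unit ball is extreme iff it slides in no nonzero direction. For sufficiency, if `T`
slides along `A`, then `T x` slides along `A x` at each attaining vertex `x`, so `A x = 0` there;
six vertices contain a cube edge in each coordinate direction, hence `A = 0`.

For necessity, up to sign the cube has four vertices: `x` and its three flips. A rank-one
perturbation moves the images of any two of them and fixes the other two, so these two images cannot
slide in a common nonzero direction (`eq_zero_of_slides_flipSign`). A point of norm below 1 slides
in every direction, so at most one antipodal pair misses the norm, leaving six vertices. If `T x` is
a unit vector sliding along `v ≠ 0`, the flips all have unit images. Since `x` is the sum of its
flips, `T x` and the negated images are four unit vectors with sum zero, and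
`exists_slides_of_add_sum_eq_zero` makes another of them slide along `v`, a contradiction. -/

/-- The unit ball contains a nondegenerate segment centred at `y` in the direction `v`. -/
def Slides {E : Type*} [NormedAddCommGroup E] [NormedSpace ℝ E] (y v : E) : Prop :=
  ∃ ε : ℝ, 0 < ε ∧ ‖y + ε • v‖ ≤ 1 ∧ ‖y - ε • v‖ ≤ 1

/-! ### Extreme points and sliding directions -/

section Slides

variable {E : Type*} [NormedAddCommGroup E] [NormedSpace ℝ E]

theorem mem_extBall_iff {y : E} :
    y ∈ extBall E ↔ ‖y‖ ≤ 1 ∧ ∀ v, Slides y v → v = 0 := by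
  constructor
  · rintro hy
    refine ⟨by simpa using hy.1, ?_⟩
    rintro v ⟨ε, hε, h₁, h₂⟩
    have h := hy.2 (x₁ := y + ε • v) (by simpa using h₁) (x₂ := y - ε • v) (by simpa using h₂)
      ⟨1 / 2, 1 / 2, by norm_num, by norm_num, by norm_num, by module⟩
    simpa [hε.ne'] using h
  · rintro ⟨hy, h⟩
    refine ⟨by simpa using hy, ?_⟩
    rintro x₁ hx₁ x₂ hx₂ ⟨a, b, ha, hb, hab, rfl⟩
    simp only [mem_closedBall_zero_iff] at hx₁ hx₂
    have key : ∀ c d : ℝ, 0 ≤ c → 0 ≤ d → c + d = 1 → ‖c • x₁ + d • x₂‖ ≤ 1 := by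
      intro c d hc hd hcd
      simpa using convex_closedBall (0 : E) 1 (by simpa using hx₁) (by simpa using hx₂) hc hd hcd
    -- Shifting by `min a b` keeps both weights nonnegative, so the point stays on the segment.
    have hv := h (x₁ - x₂) ⟨min a b, lt_min ha hb, by
        convert! key (a + min a b) (b - min a b) (by positivity) (by simp) (by linarith) using 2
        module, by
        convert! key (a - min a b) (b + min a b) (by simp) (by positivity) (by linarith) using 2
        module⟩
    rw [← sub_eq_zero.1 hv, ← add_smul, hab, one_smul]

theorem Slides.of_norm_lt_one {y : E} (hy : ‖y‖ < 1) (v : E) : Slides y v := by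
  have hpos : 0 < ‖v‖ + 1 := by positivity
  have hle : (1 - ‖y‖) / (‖v‖ + 1) * ‖v‖ ≤ 1 - ‖y‖ := by
    rw [div_mul_eq_mul_div, div_le_iff₀ hpos]
    nlinarith
  have hε : 0 < (1 - ‖y‖) / (‖v‖ + 1) := div_pos (by linarith) hpos
  have hn : ‖((1 - ‖y‖) / (‖v‖ + 1)) • v‖ ≤ 1 - ‖y‖ := by
    rwa [norm_smul, Real.norm_of_nonneg hε.le]
  exact ⟨_, hε, (norm_add_le _ _).trans (by linarith), (norm_sub_le _ _).trans (by linarith)⟩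

theorem Slides.neg {y v : E} : Slides y v → Slides (-y) v := by
  rintro ⟨ε, hε, h₁, h₂⟩
  refine ⟨ε, hε, ?_, ?_⟩
  · rw [← norm_neg]; convert! h₂ using 2; abel
  · rw [← norm_neg]; convert! h₁ using 2; abel

theorem norm_add_smul_le_one_of_abs_le {y v : E} {ε δ : ℝ} (hε : 0 < ε) (h₁ : ‖y + ε • v‖ ≤ 1)
    (h₂ : ‖y - ε • v‖ ≤ 1) (hδ : |δ| ≤ ε) : ‖y + δ • v‖ ≤ 1 := by
  obtain ⟨h₃, h₄⟩ := abs_le.1 hδ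
  have h := (convex_closedBall (0 : E) 1) (mem_closedBall_zero_iff.2 h₁)
    (mem_closedBall_zero_iff.2 h₂) (a := (ε + δ) / (2 * ε)) (b := (ε - δ) / (2 * ε))
    (div_nonneg (by linarith) (by linarith)) (div_nonneg (by linarith) (by linarith))
    (by field_simp; ring)
  rw [mem_closedBall_zero_iff] at h
  convert! h using 2
  match_scalars <;> field_simp <;> ring

/-- Two points of the unit ball that can be moved in the direction `v` can be moved by a common
amount. -/
theorem Slides.common {y z v : E} (hy : Slides y v) (hz : Slides z v) :
    ∃ ε : ℝ, 0 < ε ∧ ∀ δ : ℝ, |δ| ≤ ε → ‖y + δ • v‖ ≤ 1 ∧ ‖z + δ • v‖ ≤ 1 := by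
  obtain ⟨ε, hε, h₁, h₂⟩ := hy
  obtain ⟨ε', hε', h₁', h₂'⟩ := hz
  exact ⟨min ε ε', lt_min hε hε', fun δ hδ =>
    ⟨norm_add_smul_le_one_of_abs_le hε h₁ h₂ (hδ.trans (min_le_left _ _)),
      norm_add_smul_le_one_of_abs_le hε' h₁' h₂' (hδ.trans (min_le_right _ _))⟩⟩

end Slides

/-! ### Vertices of the cube and rank-one perturbations -/

section Cube

theorem mem_extBall_pi {ι : Type*} [Fintype ι] {x : ι → ℝ} :
    x ∈ extBall (ι → ℝ) ↔ ∀ i, x i = 1 ∨ x i = -1 := by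
  have h : Metric.closedBall (0 : ι → ℝ) 1 = Set.univ.pi fun _ => Set.Icc (-1 : ℝ) 1 := by
    rw [closedBall_pi _ zero_le_one]
    simp [Real.closedBall_eq_Icc]
  rw [extBall, h, extremePoints_pi, Set.extremePoints_Icc (by norm_num)]
  simp [or_comm]

theorem norm_eq_one_of_mem_extBall_pi {ι : Type*} [Fintype ι] [Nonempty ι] {x : ι → ℝ}
    (hx : x ∈ extBall (ι → ℝ)) : ‖x‖ = 1 := by
  have h : ∀ i, ‖x i‖ = 1 := fun i => by rcases mem_extBall_pi.1 hx i with h | h <;> simp [h]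
  refine le_antisymm ((pi_norm_le_iff_of_nonneg zero_le_one).2 fun i => (h i).le) ?_
  exact (h (Classical.arbitrary ι)).symm.le.trans (norm_le_pi_norm x _)

/-- An operator that maps the vertices of a ball to the unit ball is a contraction. -/
theorem opNorm_le_one_of_extBall {E F : Type*} [NormedAddCommGroup E] [NormedSpace ℝ E]
    [FiniteDimensional ℝ E] [NormedAddCommGroup F] [NormedSpace ℝ F] (A : E →L[ℝ] F)
    (h : ∀ x ∈ extBall E, ‖A x‖ ≤ 1) : ‖A‖ ≤ 1 := by
  have : ProperSpace E := FiniteDimensional.proper ℝ E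
  have hball : Metric.closedBall (0 : E) 1 ⊆ A ⁻¹' Metric.closedBall (0 : F) 1 := by
    rw [← closure_convexHull_extremePoints (isCompact_closedBall (0 : E) 1)
      (convex_closedBall (0 : E) 1)]
    refine closure_minimal (convexHull_min (fun x hx => by simpa using h x hx) ?_) ?_
    · exact (convex_closedBall (0 : F) 1).linear_preimage A.toLinearMap
    · exact Metric.isClosed_closedBall.preimage A.continuous
  refine A.opNorm_le_of_unit_norm zero_le_one fun x hx => ?_
  simpa using hball (show x ∈ Metric.closedBall (0 : E) 1 by simp [hx])

/-- The vector `x` with the sign of its `j`-th coordinate changed. -/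
def flipSign (x : Fin 3 → ℝ) (j : Fin 3) : Fin 3 → ℝ := Function.update x j (-x j)

theorem flipSign_mem_extBall {x : Fin 3 → ℝ} (hx : x ∈ extBall (Fin 3 → ℝ)) (j : Fin 3) :
    flipSign x j ∈ extBall (Fin 3 → ℝ) := by
  rw [mem_extBall_pi] at hx ⊢
  intro i
  rcases eq_or_ne i j with rfl | hij
  · rcases hx i with h | h <;> simp [flipSign, h]
  · simpa [flipSign, hij] using hx i

theorem sum_flipSign (x : Fin 3 → ℝ) : ∑ j, flipSign x j = x := by
  ext i
  fin_cases i <;> simp [flipSign, Fin.sum_univ_three, Function.update_apply]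

/-- Changing two signs of `x` gives the negative of changing the third. -/
theorem eq_or_eq_flipSign {x z : Fin 3 → ℝ} (hx : x ∈ extBall (Fin 3 → ℝ))
    (hz : z ∈ extBall (Fin 3 → ℝ)) :
    z = x ∨ z = -x ∨ ∃ j, z = flipSign x j ∨ z = -flipSign x j := by
  rw [mem_extBall_pi] at hx hz
  have h : ∀ i, z i = x i ∨ z i = -x i := fun i => by
    rcases hx i with h | h <;> rcases hz i with h' | h' <;> simp [h, h']
  rcases h 0 with h0 | h0 <;> rcases h 1 with h1 | h1 <;> rcases h 2 with h2 | h2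
  · left; ext i; fin_cases i <;> simp [h0, h1, h2]
  · right; right; refine ⟨2, .inl ?_⟩; ext i; fin_cases i <;> simp [h0, h1, h2, flipSign]
  · right; right; refine ⟨1, .inl ?_⟩; ext i; fin_cases i <;> simp [h0, h1, h2, flipSign]
  · right; right; refine ⟨0, .inr ?_⟩; ext i; fin_cases i <;> simp [h0, h1, h2, flipSign]
  · right; right; refine ⟨0, .inl ?_⟩; ext i; fin_cases i <;> simp [h0, h1, h2, flipSign]
  · right; right; refine ⟨1, .inr ?_⟩; ext i; fin_cases i <;> simp [h0, h1, h2, flipSign]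
  · right; right; refine ⟨2, .inr ?_⟩; ext i; fin_cases i <;> simp [h0, h1, h2, flipSign]
  · right; left; ext i; fin_cases i <;> simp [h0, h1, h2]

/-- A functional that takes the value `1` at the vertices `x` and `flipSign x j` of the cube, and
vanishes at the vertices other than these two and their opposites. -/
theorem exists_functional_flipSign {x : Fin 3 → ℝ} (hx : x ∈ extBall (Fin 3 → ℝ)) (j : Fin 3) :
    ∃ g : (Fin 3 → ℝ) →L[ℝ] ℝ,
      g x = 1 ∧ g (flipSign x j) = 1 ∧ ∀ k, k ≠ j → g (flipSign x k) = 0 := by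
  rw [mem_extBall_pi] at hx
  have hsq : ∀ i, x i * x i = 1 := fun i => by rcases hx i with h | h <;> simp [h]
  -- Half the sum of `x i * u i` over the two indices `i ≠ j`; flipping one of these makes the two
  -- terms cancel.
  let G : (Fin 3 → ℝ) →L[ℝ] ℝ :=
    (1 / 2 : ℝ) • ((∑ i, x i • ContinuousLinearMap.proj (R := ℝ) (φ := fun _ : Fin 3 => ℝ) i)
      - x j • ContinuousLinearMap.proj (R := ℝ) (φ := fun _ : Fin 3 => ℝ) j)
  have hG : ∀ u, G u = (x 0 * u 0 + x 1 * u 1 + x 2 * u 2 - x j * u j) / 2 := fun u => by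
    simp [G, Fin.sum_univ_three]; ring
  refine ⟨G, ?_, ?_, fun k hk => ?_⟩
  · rw [hG, hsq, hsq, hsq, hsq]; norm_num
  · rw [hG]
    fin_cases j <;> simp [flipSign, hsq]
  · rw [hG]
    fin_cases j <;> fin_cases k <;> simp [flipSign, hsq] at hk ⊢

/-- The images under an extreme contraction of two nonopposite vertices of the cube cannot be moved
in a common direction. -/
theorem eq_zero_of_slides_flipSign {Y : Type*} [NormedAddCommGroup Y] [NormedSpace ℝ Y]
    {T : (Fin 3 → ℝ) →L[ℝ] Y} (hT : IsExtremeContraction T) {x : Fin 3 → ℝ}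
    (hx : x ∈ extBall (Fin 3 → ℝ)) {j : Fin 3} {v : Y} (h₁ : Slides (T x) v)
    (h₂ : Slides (T (flipSign x j)) v) : v = 0 := by
  obtain ⟨g, hgx, hgj, hgk⟩ := exists_functional_flipSign hx j
  obtain ⟨ε, hε, hmove⟩ := h₁.common h₂
  rw [IsExtremeContraction, mem_extBall_iff] at hT
  obtain ⟨hT1, hT⟩ := hT
  have hle : ∀ z ∈ extBall (Fin 3 → ℝ), ‖T z‖ ≤ 1 := fun z hz =>
    (T.le_of_opNorm_le hT1 z).trans (by rw [norm_eq_one_of_mem_extBall_pi hz, one_mul])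
  have key : ∀ δ : ℝ, |δ| ≤ ε → ‖T + δ • g.smulRight v‖ ≤ 1 := by
    intro δ hδ
    have hneg : ∀ u, ‖(T + δ • g.smulRight v) (-u)‖ = ‖(T + δ • g.smulRight v) u‖ := fun u => by
      rw [map_neg, norm_neg]
    have hxle : ‖(T + δ • g.smulRight v) x‖ ≤ 1 := by simpa [hgx] using (hmove δ hδ).1
    have hfle : ∀ k, ‖(T + δ • g.smulRight v) (flipSign x k)‖ ≤ 1 := fun k => by
      rcases eq_or_ne k j with rfl | hk
      · simpa [hgj] using (hmove δ hδ).2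
      · simpa [hgk k hk] using hle _ (flipSign_mem_extBall hx k)
    refine opNorm_le_one_of_extBall _ fun z hz => ?_
    rcases eq_or_eq_flipSign hx hz with rfl | rfl | ⟨k, rfl | rfl⟩
    · exact hxle
    · rw [hneg]; exact hxle
    · exact hfle k
    · rw [hneg]; exact hfle k
  have h := hT (g.smulRight v) ⟨ε, hε, key ε (by rw [abs_of_pos hε]), by
    rw [sub_eq_add_neg, ← neg_smul]
    exact key (-ε) (by rw [abs_neg, abs_of_pos hε])⟩
  simpa [hgx] using congrArg (fun A : (Fin 3 → ℝ) →L[ℝ] Y => A x) h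

/-- The eight vertices of the cube, as a finite set. -/
noncomputable def vertices : Finset (Fin 3 → ℝ) := Fintype.piFinset fun _ => {1, -1}

theorem coe_vertices : (vertices : Set (Fin 3 → ℝ)) = extBall (Fin 3 → ℝ) := by
  ext x; simp [vertices, mem_extBall_pi]

theorem card_pair_one_neg_one : ({1, -1} : Finset ℝ).card = 2 :=
  Finset.card_pair (by norm_num)

theorem card_vertices : vertices.card = 8 := by
  simp [vertices, card_pair_one_neg_one]

/-- Any six vertices of the cube include two that differ in the `i`-th coordinate only. -/
theorem exists_single_eq_of_six_le {S : Set (Fin 3 → ℝ)} (hS : S ⊆ extBall (Fin 3 → ℝ))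
    (h6 : 6 ≤ S.encard) (i : Fin 3) :
    ∃ x ∈ S, ∃ y ∈ S, ∃ c : ℝ, Pi.single i 1 = c • (x - y) := by
  have hfin : S.Finite := (coe_vertices ▸ vertices.finite_toSet).subset hS
  lift S to Finset (Fin 3 → ℝ) using hfin
  rw [Set.encard_coe_eq_coe_finsetCard] at h6
  have h6' : 6 ≤ S.card := by exact_mod_cast h6
  let t : Finset (Fin 3 → ℝ) := Fintype.piFinset fun k => if k = i then {1} else {1, -1}
  have ht : t.card = 4 := by
    simp only [t, Fintype.card_piFinset, Fin.prod_univ_three]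
    fin_cases i <;> simp [card_pair_one_neg_one]
  -- Pigeonhole: only four cube edges are parallel to the `i`-th axis.
  obtain ⟨x, hx, y, hy, hne, hxy⟩ := Finset.exists_ne_map_eq_of_card_lt_of_maps_to
    (s := S) (t := t) (f := fun x => Function.update x i 1) (by omega) (by
      intro x hx
      have h := mem_extBall_pi.1 (hS hx)
      simp only [t, Finset.mem_coe, Fintype.mem_piFinset]
      intro k
      by_cases hk : k = i
      · subst hk; simp
      · simpa [hk] using h k)
  have hoff : ∀ k, k ≠ i → x k = y k := fun k hk => by
    simpa [hk] using congrFun hxy k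
  have hi : x i - y i ≠ 0 := fun h => hne <| by
    ext k
    by_cases hk : k = i
    · subst hk; exact sub_eq_zero.1 h
    · exact hoff k hk
  refine ⟨x, hx, y, hy, (x i - y i)⁻¹, ?_⟩
  ext k
  by_cases hk : k = i
  · subst hk; simp [hi]
  · simp [hk, hoff k hk]

end Cube

/-! ### Sufficiency -/

/-- The sufficient condition. -/
theorem isExtremeContraction_of_six_le {Y : Type*} [NormedAddCommGroup Y] [NormedSpace ℝ Y]
    {T : (Fin 3 → ℝ) →L[ℝ] Y} (hT : ‖T‖ = 1)
    (h6 : 6 ≤ (normAttainmentSet T ∩ extBall (Fin 3 → ℝ)).encard)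
    (hsub : T '' (normAttainmentSet T ∩ extBall (Fin 3 → ℝ)) ⊆ extBall Y) :
    IsExtremeContraction T := by
  rw [IsExtremeContraction, mem_extBall_iff]
  refine ⟨hT.le, ?_⟩
  rintro A ⟨ε, hε, h₁, h₂⟩
  have hzero : ∀ x ∈ normAttainmentSet T ∩ extBall (Fin 3 → ℝ), A x = 0 := by
    intro x hx
    refine (mem_extBall_iff.1 (hsub ⟨x, hx, rfl⟩)).2 _ ⟨ε, hε, ?_, ?_⟩
    · simpa [hx.1.1] using (T + ε • A).le_of_opNorm_le h₁ x
    · simpa [hx.1.1] using (T - ε • A).le_of_opNorm_le h₂ x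
  have hlin : (A : (Fin 3 → ℝ) →ₗ[ℝ] Y) = 0 := by
    refine LinearMap.pi_ext' fun i => LinearMap.ext_ring ?_
    obtain ⟨x, hx, y, hy, c, hc⟩ := exists_single_eq_of_six_le Set.inter_subset_right h6 i
    simp [hc, hzero x hx, hzero y hy]
  ext1 x
  exact LinearMap.congr_fun hlin x

/-! ### Four unit vectors with sum zero in a plane -/

section Planar

/-- Two points of the upper boundary of a planar ball `P` containing `(-1, 1)`, and a third one,
cannot sum to a point `(-1, -t)` with `-1 < t`. -/
theorem planar_not_both_upper {s₁ s₂ s₃ h₁ h₂ h₃ t a₁ b₁ a₂ b₂ : ℝ} (hs : s₁ + s₂ + s₃ = -1)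
    (hh : h₁ + h₂ + h₃ = -t) (ht : -1 < t) (hs₁ : -1 < s₁) (hs₂ : -1 < s₂)
    (hb₁ : 0 < b₁) (hb₂ : 0 < b₂) (h₁₁ : a₁ * s₁ + b₁ * h₁ = 1) (h₂₂ : a₂ * s₂ + b₂ * h₂ = 1)
    (hc₁ : a₁ * (-1) + b₁ * 1 ≤ 1) (hc₂ : a₂ * (-1) + b₂ * 1 ≤ 1)
    (h₁₃ : a₁ * (-s₃) + b₁ * (-h₃) ≤ 1) (h₂₃ : a₂ * (-s₃) + b₂ * (-h₃) ≤ 1) : False := by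
  -- Concavity of the upper boundary: `s` is the average of `-1` and `-s₃` with weights proportional
  -- to `1 + s'` and `1 + s`. Adding the two instances gives `1 ≤ h₁ + h₂ + h₃ = -t`.
  have key : ∀ a b s s' h : ℝ, -1 < s → -1 < s' → s + s' + s₃ = -1 → 0 < b → a * s + b * h = 1 →
      a * (-1) + b * 1 ≤ 1 → a * (-s₃) + b * (-h₃) ≤ 1 →
      (1 + s') + (1 + s) * (-h₃) ≤ (2 + s + s') * h := by
    intro a b s s' h hs hs' hsum hb h1 h2 h3
    have h4 := mul_le_mul_of_nonneg_left h2 (by linarith : 0 ≤ 1 + s')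
    have h5 := mul_le_mul_of_nonneg_left h3 (by linarith : 0 ≤ 1 + s)
    refine le_of_mul_le_mul_left ?_ hb
    have h6 : b * ((2 + s + s') * h) = (2 + s + s') * (1 - a * s) := by rw [← h1]; ring
    have h7 : s₃ = -1 - s - s' := by linarith
    rw [h6]
    subst h7
    linarith
  have k₁ := key a₁ b₁ s₁ s₂ h₁ hs₁ hs₂ hs hb₁ h₁₁ hc₁ h₁₃
  have k₂ := key a₂ b₂ s₂ s₁ h₂ hs₂ hs₁ (by linarith) hb₂ h₂₂ hc₂ h₂₃
  have hpos : 0 < (2 + s₁ + s₂) * (1 + t) := mul_pos (by linarith) (by linarith)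
  have h7 : h₃ = -t - h₁ - h₂ := by linarith
  subst h7
  linarith

/-- Let `P` be a symmetric planar ball that contains the square `[-1, 1]²`, lies in the strip
`|x| ≤ 1` and has `{1} × [-1, 1]` as an edge. Three boundary points of `P`, none of them inside the
edge or its opposite, do not sum to the opposite of a point inside that edge. -/
theorem planar_sum_ne {P : ℝ → ℝ → Prop} (hone : P 1 1) (honeneg : P 1 (-1))
    (hneg : ∀ x y, P x y → P (-x) (-y)) (hstrip : ∀ x y, P x y → |x| ≤ 1)
    {s h : Fin 3 → ℝ} {t : ℝ} (ht : |t| < 1) (hs : s 0 + s 1 + s 2 = -1)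
    (hh : h 0 + h 1 + h 2 = -t) (hP : ∀ i, P (s i) (h i))
    (hdual : ∀ i, ∃ a b, a * s i + b * h i = 1 ∧ ∀ x y, P x y → a * x + b * y ≤ 1)
    (hedge : ∀ i, |s i| = 1 → |h i| = 1) : False := by
  choose a b hab hle using hdual
  obtain ⟨ht₁, ht₂⟩ := abs_lt.1 ht
  -- Each point is a corner of the square, or on the upper or lower boundary according to the sign
  -- of `b i`; `b i = 0` would force `|s i| = 1`.
  have hclass : ∀ i, (s i = 1 ∨ s i = -1) ∧ (h i = 1 ∨ h i = -1) ∨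
      (-1 < s i ∧ s i < 1) ∧ 0 < b i ∨ (-1 < s i ∧ s i < 1) ∧ b i < 0 := by
    intro i
    rcases (hstrip _ _ (hP i)).eq_or_lt with he | hlt
    · exact .inl ⟨eq_or_eq_neg_of_abs_eq he, eq_or_eq_neg_of_abs_eq (hedge i he)⟩
    · obtain ⟨h₁, h₂⟩ := abs_lt.1 hlt
      rcases lt_trichotomy (b i) 0 with hb | hb | hb
      · exact .inr (.inr ⟨⟨h₁, h₂⟩, hb⟩)
      · exfalso
        have e := hab i
        have e₁ := hle i _ _ hone
        have e₂ := hle i _ _ (hneg _ _ hone)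
        simp only [hb, zero_mul, add_zero, neg_zero, mul_one, mul_neg] at e e₁ e₂
        have e₃ := mul_nonneg (sub_nonneg.2 e₁) (by linarith : 0 ≤ 1 + s i)
        have e₄ := mul_nonneg (sub_nonneg.2 e₂) (sub_nonneg.2 h₂.le)
        have e₅ : a i = s i := by linarith
        have e₆ := mul_pos (sub_pos.2 h₂) (by linarith : 0 < 1 + s i)
        rw [e₅] at e
        linarith
      · exact .inr (.inl ⟨⟨h₁, h₂⟩, hb⟩)
  have hupper : ∀ i j k, s i + s j + s k = -1 → h i + h j + h k = -t →
      (-1 < s i ∧ s i < 1) ∧ 0 < b i → (-1 < s j ∧ s j < 1) ∧ 0 < b j → False := by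
    intro i j k hs hh hi hj
    have hc : P (-1) 1 := by simpa using hneg _ _ honeneg
    exact planar_not_both_upper hs hh ht₁ hi.1.1 hj.1.1 hi.2 hj.2 (hab i) (hab j)
      (hle i _ _ hc) (hle j _ _ hc) (hle i _ _ (hneg _ _ (hP k))) (hle j _ _ (hneg _ _ (hP k)))
  have hlower : ∀ i j k, s i + s j + s k = -1 → h i + h j + h k = -t →
      (-1 < s i ∧ s i < 1) ∧ b i < 0 → (-1 < s j ∧ s j < 1) ∧ b j < 0 → False := by
    intro i j k hs hh hi hj
    have hc : P (-1) (-1) := by simpa using hneg _ _ hone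
    refine planar_not_both_upper (h₁ := -h i) (h₂ := -h j) (h₃ := -h k) (t := -t) (a₁ := a i)
      (b₁ := -b i) (a₂ := a j) (b₂ := -b j) hs (by linarith) (by linarith) hi.1.1 hj.1.1 (by linarith [hi.2])
      (by linarith [hj.2]) (by rw [← hab i]; ring) (by rw [← hab j]; ring)
      (by linarith [hle i _ _ hc]) (by linarith [hle j _ _ hc])
      (by linarith [hle i _ _ (hneg _ _ (hP k))]) (by linarith [hle j _ _ (hneg _ _ (hP k))])
  have hmixed : ∀ i j k, s i + s j + s k = -1 → h i + h j + h k = -t →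
      (-1 < s i ∧ s i < 1) ∧ 0 < b i → (-1 < s j ∧ s j < 1) ∧ b j < 0 →
      (s k = 1 ∨ s k = -1) ∧ (h k = 1 ∨ h k = -1) → False := by
    rintro i j k hs hh hi hj ⟨hk | hk, hk'⟩
    · linarith [hi.1.1, hj.1.1]
    -- Point `j` lies over the same abscissa as the opposite of point `i`, so the supporting lines
    -- force `h i + h j = 0` and `h k = -t`, which is not `±1`.
    · have hsj : s j = -s i := by linarith
      have e₁ := hle i _ _ (hneg _ _ (hP j))
      have e₂ := hle j _ _ (hneg _ _ (hP i))
      have e₃ := hab i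
      have e₄ := hab j
      rw [hsj] at e₁ e₄
      have e₅ : 0 ≤ b i * (h i + h j) := by linarith
      have e₆ : 0 ≤ -b j * -(h i + h j) := by linarith
      have e₇ := nonneg_of_mul_nonneg_right e₅ hi.2
      have e₈ := nonneg_of_mul_nonneg_right e₆ (by linarith [hj.2])
      rcases hk' with hk' | hk' <;> linarith
  -- With two corners, the third abscissa would be an odd integer; with three, `t` would be.
  rcases hclass 0 with c₀ | c₀ | c₀ <;> rcases hclass 1 with c₁ | c₁ | c₁ <;>
    rcases hclass 2 with c₂ | c₂ | c₂ <;>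
    first
    | exact hupper 0 1 2 hs hh c₀ c₁
    | exact hupper 0 2 1 (by linarith) (by linarith) c₀ c₂
    | exact hupper 1 2 0 (by linarith) (by linarith) c₁ c₂
    | exact hlower 0 1 2 hs hh c₀ c₁
    | exact hlower 0 2 1 (by linarith) (by linarith) c₀ c₂
    | exact hlower 1 2 0 (by linarith) (by linarith) c₁ c₂
    | exact hmixed 0 1 2 hs hh c₀ c₁ c₂
    | exact hmixed 1 0 2 (by linarith) (by linarith) c₁ c₀ c₂
    | exact hmixed 0 2 1 (by linarith) (by linarith) c₀ c₂ c₁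
    | exact hmixed 2 0 1 (by linarith) (by linarith) c₂ c₀ c₁
    | exact hmixed 1 2 0 (by linarith) (by linarith) c₁ c₂ c₀
    | exact hmixed 2 1 0 (by linarith) (by linarith) c₂ c₁ c₀
    | (obtain ⟨⟨_, _⟩, _⟩ := c₀
       rcases c₁.1 with _ | _ <;> rcases c₂.1 with _ | _ <;> linarith)
    | (obtain ⟨⟨_, _⟩, _⟩ := c₁
       rcases c₀.1 with _ | _ <;> rcases c₂.1 with _ | _ <;> linarith)
    | (obtain ⟨⟨_, _⟩, _⟩ := c₂
       rcases c₀.1 with _ | _ <;> rcases c₁.1 with _ | _ <;> linarith)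
    | (rcases c₀.2 with _ | _ <;> rcases c₁.2 with _ | _ <;> rcases c₂.2 with _ | _ <;> linarith)

/-- Coordinates adapted to the edge of the unit ball of a plane that has `y` in its relative
interior: the edge is `{c + r • w | |r| ≤ 1}`. -/
theorem exists_edge_coordinates {Y : Type*} [NormedAddCommGroup Y] [NormedSpace ℝ Y]
    (hY : Module.finrank ℝ Y = 2) {y v : Y} (hy : ‖y‖ = 1) (hv : v ≠ 0) (hyv : Slides y v) :
    ∃ (f : StrongDual ℝ Y) (c w : Y) (r t : ℝ), ‖f‖ = 1 ∧ f c = 1 ∧ f w = 0 ∧ v = r • w ∧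
      |t| < 1 ∧ y = c + t • w ∧ w ≠ 0 ∧ ‖c + w‖ ≤ 1 ∧ ‖c - w‖ ≤ 1 ∧
      (∀ u : ℝ, ‖c + u • w‖ ≤ 1 → |u| ≤ 1) ∧ ∀ z, ∃ s h : ℝ, z = s • c + h • w := by
  obtain ⟨f, hf, hfy⟩ := exists_dual_vector ℝ y (by simp [hy])
  replace hfy : f y = 1 := by simpa [hy] using hfy
  have hfle : ∀ z, ‖z‖ ≤ 1 → f z ≤ 1 := fun z hz =>
    (le_abs_self _).trans ((f.le_of_opNorm_le hf.le z).trans (by simpa using hz))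
  obtain ⟨ε, hε, h₁, h₂⟩ := hyv
  -- `f` attains its maximum over the ball at the midpoint `y` of a segment along `v`.
  have hfv : f v = 0 := by
    have e₁ := hfle _ h₁
    have e₂ := hfle _ h₂
    simp only [map_add, map_sub, map_smul, smul_eq_mul, hfy] at e₁ e₂
    nlinarith
  let K : Set ℝ := {r | ‖y + r • v‖ ≤ 1}
  have hKclosed : IsClosed K := isClosed_le (by fun_prop) continuous_const
  have hKbdd : Bornology.IsBounded K := by
    refine (Metric.isBounded_closedBall (x := (0 : ℝ)) (r := 2 / ‖v‖)).subset fun r hr => ?_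
    rw [mem_closedBall_zero_iff, le_div_iff₀ (norm_pos_iff.2 hv), ← norm_smul]
    calc ‖r • v‖ = ‖(y + r • v) - y‖ := by simp
      _ ≤ ‖y + r • v‖ + ‖y‖ := norm_sub_le _ _
      _ ≤ 1 + 1 := add_le_add hr hy.le
      _ = 2 := by norm_num
  have hK := Metric.isCompact_of_isClosed_isBounded hKclosed hKbdd
  have hεK : ε ∈ K := h₁
  have hεK' : -ε ∈ K := by simpa [K, sub_eq_add_neg] using h₂
  obtain ⟨b, hbK, hb⟩ := hK.exists_isGreatest ⟨ε, hεK⟩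
  obtain ⟨a, haK, ha⟩ := hK.exists_isLeast ⟨ε, hεK⟩
  have hb0 : ε ≤ b := hb hεK
  have ha0 : a ≤ -ε := ha hεK'
  have hba : 0 < b - a := by linarith
  have hfc : f (y + ((a + b) / 2) • v) = 1 := by simp [hfy, hfv]
  have hfw : f (((b - a) / 2) • v) = 0 := by simp [hfv]
  have hw : ((b - a) / 2) • v ≠ 0 := smul_ne_zero (by linarith) hv
  -- `c` is the midpoint of the maximal segment through `y` along `v`, and `w` is half of it.
  refine ⟨f, y + ((a + b) / 2) • v, ((b - a) / 2) • v, 2 / (b - a), -(a + b) / (b - a), hf, hfc, hfw,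
    ?_, ?_, ?_, hw, ?_, ?_, ?_, ?_⟩
  · match_scalars; field_simp
  · rw [abs_div, abs_of_pos hba, div_lt_one hba, abs_lt]
    constructor <;> linarith
  · match_scalars <;> field_simp <;> ring
  · change ‖y + b • v‖ ≤ 1 at hbK
    convert! hbK using 2; module
  · change ‖y + a • v‖ ≤ 1 at haK
    convert! haK using 2; module
  · intro u hu
    have huK : (a + b) / 2 + u * ((b - a) / 2) ∈ K := by
      change ‖_‖ ≤ 1
      convert! hu using 2; module
    have e₁ := hb huK
    have e₂ := ha huK
    rw [abs_le]
    constructor <;> nlinarith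
  · have hli : LinearIndependent ℝ ![y + ((a + b) / 2) • v, ((b - a) / 2) • v] := by
      refine LinearIndependent.pair_iff.2 fun s h hsh => ?_
      have hs : s = 0 := by
        have e := congrArg f hsh
        rw [map_add, map_smul, map_smul, hfc, hfw] at e
        simpa using e
      refine ⟨hs, ?_⟩
      rw [hs, zero_smul, zero_add] at hsh
      exact (smul_eq_zero.1 hsh).resolve_right hw
    have hspan := hli.span_eq_top_of_card_eq_finrank (by simp [hY])
    intro z
    have hz : z ∈ Submodule.span ℝ (Set.range ![y + ((a + b) / 2) • v, ((b - a) / 2) • v]) := by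
      rw [hspan]; trivial
    rw [Matrix.range_cons_cons_empty, Submodule.mem_span_pair] at hz
    obtain ⟨s, h, hz⟩ := hz
    exact ⟨s, h, hz.symm⟩

/-- If four unit vectors of a plane sum to zero and one of them lies inside an edge of the unit
ball, then another one lies inside a parallel edge. -/
theorem exists_slides_of_add_sum_eq_zero {Y : Type*} [NormedAddCommGroup Y] [NormedSpace ℝ Y]
    (hY : Module.finrank ℝ Y = 2) {y v : Y} (hy : ‖y‖ = 1) (hv : v ≠ 0) (hyv : Slides y v)
    {z : Fin 3 → Y} (hz : ∀ i, ‖z i‖ = 1) (hsum : y + ∑ i, z i = 0) : ∃ i, Slides (z i) v := by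
  by_contra! hnot
  obtain ⟨f, c, w, r, t, hf, hfc, hfw, hvw, ht, hyt, hw, hcw, hcw', hedge, hspan⟩ :=
    exists_edge_coordinates hY hy hv hyv
  choose s h hsh using fun i => hspan (z i)
  have hr : r ≠ 0 := by rintro rfl; simp [hvw] at hv
  have hsum' : (1 + (s 0 + s 1 + s 2)) • c + (t + (h 0 + h 1 + h 2)) • w = 0 := by
    rw [← hsum, Fin.sum_univ_three, hyt, hsh 0, hsh 1, hsh 2]; module
  have hs : 1 + (s 0 + s 1 + s 2) = 0 := by simpa [hfc, hfw] using congrArg f hsum'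
  have hh : t + (h 0 + h 1 + h 2) = 0 := by
    rw [hs, zero_smul, zero_add] at hsum'
    exact (smul_eq_zero.1 hsum').resolve_right hw
  have hnorm_neg : ∀ x y : ℝ, ‖-x • c + -y • w‖ = ‖x • c + y • w‖ := fun x y => by
    rw [← norm_neg]; congr 1; module
  have hslide : ∀ u : ℝ, |u| < 1 → Slides (c + u • w) v := by
    intro u hu
    obtain ⟨hu₁, hu₂⟩ := abs_lt.1 hu
    have hseg : ∀ q : ℝ, |q| ≤ 1 → ‖c + q • w‖ ≤ 1 := fun q hq =>
      norm_add_smul_le_one_of_abs_le one_pos (by simpa using hcw) (by simpa using hcw') hq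
    have hm : 0 < 1 - |u| := by linarith
    have hδ : 0 < (1 - |u|) / |r| := div_pos hm (abs_pos.2 hr)
    have habs : |(1 - |u|) / |r| * r| = 1 - |u| := by
      rw [abs_mul, abs_of_pos hδ, div_mul_cancel₀ _ (abs_ne_zero.2 hr)]
    refine ⟨(1 - |u|) / |r|, hδ, ?_, ?_⟩
    · convert! hseg (u + (1 - |u|) / |r| * r) ((abs_add_le _ _).trans (by linarith)) using 2
      rw [hvw]; module
    · convert! hseg (u - (1 - |u|) / |r| * r) ((abs_sub _ _).trans (by linarith)) using 2
      rw [hvw]; module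
  refine planar_sum_ne (P := fun x y => ‖x • c + y • w‖ ≤ 1) (s := s) (h := h) (by simpa using hcw)
    (by simpa [sub_eq_add_neg] using hcw') (fun x y hxy => by rwa [hnorm_neg]) ?_ ht
    (by linarith) (by linarith) (fun i => by rw [← hsh, hz]) ?_ ?_
  · intro x y hxy
    have e : f (x • c + y • w) = x := by rw [map_add, map_smul, map_smul, hfc, hfw]; simp
    rw [← e, ← Real.norm_eq_abs]
    exact (f.le_of_opNorm_le hf.le _).trans (by simpa using hxy)
  · intro i
    obtain ⟨φ, hφ, hφz⟩ := exists_dual_vector ℝ (z i) (by simp [hz])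
    refine ⟨φ c, φ w, ?_, fun x y hxy => ?_⟩
    · rw [hz] at hφz
      conv_lhs at hφz => rw [hsh]
      simp only [map_add, map_smul, smul_eq_mul] at hφz
      simpa [mul_comm] using hφz
    · have e := (le_abs_self _).trans (φ.le_of_opNorm_le hφ.le (x • c + y • w))
      simp only [map_add, map_smul, smul_eq_mul] at e
      linarith
  · intro i hi
    have hzi := hsh i
    by_contra hne
    rcases eq_or_eq_neg_of_abs_eq hi with h1 | h1
    · rw [h1, one_smul] at hzi
      refine hnot i (hzi ▸ hslide _ (lt_of_le_of_ne (hedge _ ?_) hne))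
      rw [← hzi, hz]
    · have hzi' : -z i = c + (-h i) • w := by rw [hzi, h1]; module
      have e := hslide (-h i) (lt_of_le_of_ne (hedge _ (by rw [← hzi', norm_neg, hz]))
        (by rwa [abs_neg]))
      rw [← hzi'] at e
      exact hnot i (by simpa using e.neg)

end Planar

/-! ### Necessity -/

/-- The necessary condition on images. -/
theorem IsExtremeContraction.map_mem_extBall {Y : Type*} [NormedAddCommGroup Y] [NormedSpace ℝ Y]
    (hY : Module.finrank ℝ Y = 2) {T : (Fin 3 → ℝ) →L[ℝ] Y} (hT : IsExtremeContraction T)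
    {x : Fin 3 → ℝ} (hx : x ∈ extBall (Fin 3 → ℝ)) (hTx : ‖T x‖ = 1) : T x ∈ extBall Y := by
  refine mem_extBall_iff.2 ⟨hTx.le, fun v hv => ?_⟩
  by_contra hv0
  have hflip : ∀ j, ‖T (flipSign x j)‖ = 1 := fun j => by
    have hle : ‖T (flipSign x j)‖ ≤ 1 := by
      simpa [norm_eq_one_of_mem_extBall_pi (flipSign_mem_extBall hx j)] using
        T.le_of_opNorm_le (mem_extBall_iff.1 hT).1 (flipSign x j)
    exact hle.eq_of_not_lt fun hlt => hv0 (eq_zero_of_slides_flipSign hT hx hv (.of_norm_lt_one hlt v))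
  obtain ⟨j, hj⟩ := exists_slides_of_add_sum_eq_zero hY (z := fun j => -T (flipSign x j)) hTx hv0 hv
    (fun j => by rw [norm_neg, hflip]) (by
      rw [Finset.sum_neg_distrib, ← map_sum, sum_flipSign, add_neg_cancel])
  exact hv0 (eq_zero_of_slides_flipSign hT hx hv (by simpa using hj.neg))

/-- The necessary condition on the number of vertices at which the norm is attained. -/
theorem IsExtremeContraction.six_le {Y : Type*} [NormedAddCommGroup Y] [NormedSpace ℝ Y]
    [Nontrivial Y] {T : (Fin 3 → ℝ) →L[ℝ] Y} (hT : IsExtremeContraction T) (hT1 : ‖T‖ = 1) :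
    6 ≤ (normAttainmentSet T ∩ extBall (Fin 3 → ℝ)).encard := by
  classical
  have hmem : ∀ z ∈ extBall (Fin 3 → ℝ), ¬ ‖T z‖ < 1 →
      z ∈ normAttainmentSet T ∩ extBall (Fin 3 → ℝ) := fun z hz hlt => by
    have hz1 := norm_eq_one_of_mem_extBall_pi hz
    refine ⟨⟨hz1, ?_⟩, hz⟩
    rw [hT1]
    exact (le_of_not_gt hlt).antisymm' (by simpa [hz1] using T.le_of_opNorm_le hT1.le z)
  obtain ⟨x, hx⟩ : ∃ x : Fin 3 → ℝ, ((vertices \ {x, -x} : Finset (Fin 3 → ℝ)) : Set (Fin 3 → ℝ)) ⊆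
      normAttainmentSet T ∩ extBall (Fin 3 → ℝ) := by
    by_cases h : ∃ x ∈ extBall (Fin 3 → ℝ), ‖T x‖ < 1
    · obtain ⟨x, hx, hTx⟩ := h
      refine ⟨x, fun z hz => ?_⟩
      rw [Finset.coe_sdiff, coe_vertices] at hz
      obtain ⟨hz, hzx⟩ := hz
      refine hmem z hz fun hTz => ?_
      obtain ⟨v, hv⟩ := exists_ne (0 : Y)
      rcases eq_or_eq_flipSign hx hz with rfl | rfl | ⟨j, rfl | rfl⟩
      · simp at hzx
      · simp at hzx
      · exact hv (eq_zero_of_slides_flipSign hT hx (.of_norm_lt_one hTx v) (.of_norm_lt_one hTz v))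
      · rw [map_neg, norm_neg] at hTz
        exact hv (eq_zero_of_slides_flipSign hT hx (.of_norm_lt_one hTx v) (.of_norm_lt_one hTz v))
    · push Not at h
      -- Here `0` is a dummy: it is not a vertex, so nothing is removed.
      refine ⟨0, fun z hz => ?_⟩
      rw [Finset.coe_sdiff, coe_vertices] at hz
      exact hmem z hz.1 (not_lt.2 (h z hz.1))
  refine le_trans ?_ (Set.encard_le_encard hx)
  rw [Set.encard_coe_eq_coe_finsetCard]
  have h₁ := Finset.le_card_sdiff {x, -x} vertices
  have h₂ := Finset.card_le_two (a := x) (b := -x)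
  rw [card_vertices] at h₁
  exact_mod_cast (by omega : 6 ≤ (vertices \ {x, -x}).card)

/-- `Fin 3 → ℝ` carries the supremum norm, so it is the real space `ℓ_∞^3`. -/
theorem mainTheorem6 {Y : Type*} [NormedAddCommGroup Y] [NormedSpace ℝ Y]
    (hY : IsPolygonalPlane Y) (T : (Fin 3 → ℝ) →L[ℝ] Y) (hT : ‖T‖ = 1) :
    IsExtremeContraction T ↔
      6 ≤ (normAttainmentSet T ∩ extBall (Fin 3 → ℝ)).encard ∧
        T '' (normAttainmentSet T ∩ extBall (Fin 3 → ℝ)) ⊆ extBall Y := by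
  have : Nontrivial Y := Module.nontrivial_of_finrank_pos (R := ℝ) (by rw [hY.1]; norm_num)
  refine ⟨fun h => ⟨h.six_le hT, ?_⟩, fun h => isExtremeContraction_of_six_le hT h.1 h.2⟩
  rintro _ ⟨x, ⟨hx, hxe⟩, rfl⟩
  exact h.map_mem_extBall hY.1 hxe (hx.2.trans hT)
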